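/- Let $G=(V,E)$ be a finite simple undirected graph with a vertex capacity function $b\colon V\to\mathbb{Z}_{\ge 0}$ and an edge weight function $w\colon E\to\mathbb{R}$. For $S\subseteq V$ let $G[S]$ be the induced subgraph, with edge set $E[S]$. A fractional $b$-matching of $G[S]$ is a vector $x\in\mathbb{R}_{\ge 0}^{E[S]}$ with $\sum_{e\in E[S],\, e\ni v}x_e\le b_v$ for every $v\in S$; a $b$-matching of $G[S]$ is an integral such vector. Let $\gamma(S)$ and $\nu^*(S)$ be the maximum of $\sum_{e\in E[S]}w_ex_e$ over all $b$-matchings, respectively all fractional $b$-matchings, of $G[S]$; thus $\nu^*(S)$ is the optimum of the natural LP-relaxation on $G[S]$. The multiple partners matching game on $G$ has player set $V$ and characteristic function $\gamma$. For real $\alpha$, its $\alpha$-approximate core is the set of all $a\in\mathbb{R}_{\ge 0}^V$ with $\sum_{i\in V}a_i\le\gamma(V)$ and $\sum_{i\in S}a_i\ge\alpha\,\gamma(S)$ for all $S\subseteq V$. **Theorem.** The $\frac23$-approximate core of every multiple partners matching game is non-empty. Moreover, $\frac23$ is the best possible factor relative to the LP-relaxation, in the following sense. 1. $\frac23$ is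 the largest real number $\alpha$ such that every multiple partners matching game has an allocation $a\in\mathbb{R}_{\ge 0}^V$ with $\sum_{i\in V}a_i\le\gamma(V)$ and $\sum_{i\in S}a_i\ge\alpha\,\nu^*(S)$ for all $S\subseteq V$. 2. The integrality gap of the maximum $b$-matching problem relative to its natural LP-relaxation, that is, the infimum of $\gamma(V)/\nu^*(V)$ over all instances $(G,b,w)$ with $\nu^*(V)>0$, equals $\frac23$ and is attained. -/

import Mathlib

universe u

/-- An undirected graph on the player set `V` with an integral vertex capacity function
and an edge weight function. The value of `weight` at a pair that is not an edge is never used. -/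
structure BMatchingGame (V : Type u) where
  graph : SimpleGraph V
  cap : V → ℕ
  weight : Sym2 V → ℝ

namespace BMatchingGame

variable {V : Type u} [Fintype V]

open Classical in
/-- The edges of the induced subgraph `G[S]`: the edges of `G` with both ends in `S`. -/
noncomputable def edgesIn (Γ : BMatchingGame V) (S : Finset V) : Finset (Sym2 V) :=
  Finset.univ.filter fun e => e ∈ Γ.graph.edgeSet ∧ ∀ v ∈ e, v ∈ S

open Classical in
/-- The edges of `G[S]` that are incident to `v`. -/
noncomputable def incidentIn (Γ : BMatchingGame V) (S : Finset V) (v : V) : Finset (Sym2 V) :=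
  (Γ.edgesIn S).filter fun e => v ∈ e

/-- `x` is a fractional `b`-matching of `G[S]`, i.e. a feasible solution of the natural
LP-relaxation on `G[S]`. Only the values of `x` on the edges of `G[S]` matter. -/
def IsFractionalBMatching (Γ : BMatchingGame V) (S : Finset V) (x : Sym2 V → ℝ) : Prop :=
  (∀ v ∈ S, ∑ e ∈ Γ.incidentIn S v, x e ≤ (Γ.cap v : ℝ)) ∧ ∀ e ∈ Γ.edgesIn S, 0 ≤ x e

/-- `x` is a `b`-matching of `G[S]`: an integral fractional `b`-matching of `G[S]`. -/
def IsBMatching (Γ : BMatchingGame V) (S : Finset V) (x : Sym2 V → ℝ) : Prop :=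
  Γ.IsFractionalBMatching S x ∧ ∀ e ∈ Γ.edgesIn S, ∃ k : ℤ, x e = (k : ℝ)

/-- The total weight of `x` in `G[S]`. -/
noncomputable def totalWeight (Γ : BMatchingGame V) (S : Finset V) (x : Sym2 V → ℝ) : ℝ :=
  ∑ e ∈ Γ.edgesIn S, Γ.weight e * x e

/-- The characteristic function of the game: the weight of maximum `b`-matchings in `G[S]`. -/
noncomputable def worth (Γ : BMatchingGame V) (S : Finset V) : ℝ :=
  sSup (Γ.totalWeight S '' {x | Γ.IsBMatching S x})

/-- The optimum of the natural LP-relaxation of the maximum `b`-matching problem on `G[S]`. -/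
noncomputable def lpValue (Γ : BMatchingGame V) (S : Finset V) : ℝ :=
  sSup (Γ.totalWeight S '' {x | Γ.IsFractionalBMatching S x})

/-- The `α`-approximate core of the game. -/
def approxCore (Γ : BMatchingGame V) (α : ℝ) : Set (V → ℝ) :=
  {a | (∀ i, 0 ≤ a i) ∧ ∑ i, a i ≤ Γ.worth Finset.univ ∧
    ∀ S : Finset V, α * Γ.worth S ≤ ∑ i ∈ S, a i}

/-- The allocations which guarantee every coalition the factor `α` even when the coalition is
measured by the optimum of the LP-relaxation on it, instead of by its worth. -/
def lpApproxCore (Γ : BMatchingGame V) (α : ℝ) : Set (V → ℝ) :=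
  {a | (∀ i, 0 ≤ a i) ∧ ∑ i, a i ≤ Γ.worth Finset.univ ∧
    ∀ S : Finset V, α * Γ.lpValue S ≤ ∑ i ∈ S, a i}

/-- The ratios of the weight of a maximum `b`-matching to the optimum of the LP-relaxation, over
all instances in which the latter does not vanish (so that the ratio makes sense). -/
def integralityRatios : Set ℝ :=
  {r | ∃ (V : Type u) (_ : Fintype V) (Γ : BMatchingGame V),
    0 < Γ.lpValue Finset.univ ∧ r = Γ.worth Finset.univ / Γ.lpValue Finset.univ}

/-- The integrality gap of the maximum `b`-matching problem relative to its natural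
LP-relaxation: the worst-case ratio over all instances. -/
noncomputable def integralityGap : ℝ := sInf integralityRatios.{u}

/-- The factors which can be guaranteed relative to the LP-relaxation in every game. -/
def lpFactors : Set ℝ :=
  {α | ∀ (V : Type u) [Fintype V] (Γ : BMatchingGame V), (Γ.lpApproxCore α).Nonempty}

/-! Both suprema are maxima. -/

theorem le_cap_of_feasible (Γ : BMatchingGame V) {S : Finset V} {x : Sym2 V → ℝ}
    (hx : Γ.IsFractionalBMatching S x) {e : Sym2 V} (he : e ∈ Γ.edgesIn S) :
    x e ≤ ∑ v, (Γ.cap v : ℝ) := by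
  classical
  induction e using Sym2.ind with
  | _ v w =>
    have hv : v ∈ S := by
      have := (Finset.mem_filter.1 he).2.2
      exact this v (Sym2.mem_mk_left v w)
    have hmem : s(v, w) ∈ Γ.incidentIn S v :=
      Finset.mem_filter.2 ⟨he, Sym2.mem_mk_left v w⟩
    calc x s(v, w) ≤ ∑ e ∈ Γ.incidentIn S v, x e :=
          Finset.single_le_sum (f := x)
            (fun e he => hx.2 e (Finset.mem_filter.1 he).1) hmem
      _ ≤ Γ.cap v := hx.1 v hv
      _ ≤ ∑ v, (Γ.cap v : ℝ) :=
          Finset.single_le_sum (f := fun v => (Γ.cap v : ℝ))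
            (fun _ _ => Nat.cast_nonneg _) (Finset.mem_univ v)

theorem isGreatest_aux (Γ : BMatchingGame V) (S : Finset V) {A : Set ℝ}
    (hA : IsClosed A) (h0 : (0 : ℝ) ∈ A) :
    IsGreatest (Γ.totalWeight S ''
        {x | Γ.IsFractionalBMatching S x ∧ ∀ e ∈ Γ.edgesIn S, x e ∈ A})
      (sSup (Γ.totalWeight S ''
        {x | Γ.IsFractionalBMatching S x ∧ ∀ e ∈ Γ.edgesIn S, x e ∈ A})) := by
  classical
  set B : ℝ := ∑ v, (Γ.cap v : ℝ) with hB
  have hB0 : 0 ≤ B := Finset.sum_nonneg fun _ _ => Nat.cast_nonneg _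
  set P : Set (Sym2 V → ℝ) :=
    {x | Γ.IsFractionalBMatching S x ∧ ∀ e ∈ Γ.edgesIn S, x e ∈ A} with hP
  have hclosed : IsClosed P := by
    have : P = ((⋂ v ∈ S, {x | ∑ e ∈ Γ.incidentIn S v, x e ≤ (Γ.cap v : ℝ)}) ∩
        ⋂ e ∈ Γ.edgesIn S, {x : Sym2 V → ℝ | 0 ≤ x e}) ∩
        ⋂ e ∈ Γ.edgesIn S, {x : Sym2 V → ℝ | x e ∈ A} := by
      ext x
      simp [hP, IsFractionalBMatching]
    rw [this]
    refine IsClosed.inter (IsClosed.inter ?_ ?_) ?_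
    · exact isClosed_biInter fun v _ => isClosed_le (by fun_prop) continuous_const
    · exact isClosed_biInter fun e _ => isClosed_le continuous_const (by fun_prop)
    · exact isClosed_biInter fun e _ => hA.preimage (continuous_apply e)
  set K : Set (Sym2 V → ℝ) := Set.Icc (fun _ => 0) (fun _ => B) ∩ P with hK
  have hKc : IsCompact K := isCompact_Icc.inter_right hclosed
  have hcont : Continuous (Γ.totalWeight S) := by
    unfold totalWeight
    fun_prop
  have himg : Γ.totalWeight S '' P = Γ.totalWeight S '' K := by
    apply Set.Subset.antisymm _ (Set.image_mono Set.inter_subset_right)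
    rintro _ ⟨x, hx, rfl⟩
    have hi : ∀ v, ∑ e ∈ Γ.incidentIn S v, (if e ∈ Γ.edgesIn S then x e else 0) =
        ∑ e ∈ Γ.incidentIn S v, x e := fun v =>
      Finset.sum_congr rfl fun e he => if_pos (Finset.mem_filter.1 he).1
    refine ⟨fun e => if e ∈ Γ.edgesIn S then x e else 0, ⟨⟨?_, ?_⟩, ⟨?_, ?_⟩, ?_⟩, ?_⟩
    · intro e
      by_cases he : e ∈ Γ.edgesIn S
      · simpa [he] using hx.1.2 e he
      · simp [he]
    · intro e
      by_cases he : e ∈ Γ.edgesIn S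
      · simpa [he] using Γ.le_cap_of_feasible hx.1 he
      · simpa [he] using hB0
    · intro v hv
      rw [hi v]
      exact hx.1.1 v hv
    · intro e he
      simpa [he] using hx.1.2 e he
    · intro e he
      simpa [he] using hx.2 e he
    · exact Finset.sum_congr rfl fun e he => by simp [he]
  rw [himg]
  refine (hKc.image hcont).isGreatest_sSup (Set.Nonempty.image _ ⟨fun _ => 0, ?_⟩)
  refine ⟨⟨fun _ => le_rfl, fun _ => hB0⟩, ⟨fun v _ => ?_, fun _ _ => le_rfl⟩, fun _ _ => h0⟩
  simp

theorem isGreatest_worth (Γ : BMatchingGame V) (S : Finset V) :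
    IsGreatest (Γ.totalWeight S '' {x | Γ.IsBMatching S x}) (Γ.worth S) := by
  have h := Γ.isGreatest_aux S (A := Set.range ((↑) : ℤ → ℝ))
    Int.isClosedEmbedding_coe_real.isClosed_range ⟨0, by simp⟩
  simpa only [worth, IsBMatching, Set.mem_range, eq_comm] using h

theorem isGreatest_lpValue (Γ : BMatchingGame V) (S : Finset V) :
    IsGreatest (Γ.totalWeight S '' {x | Γ.IsFractionalBMatching S x}) (Γ.lpValue S) := by
  have h := Γ.isGreatest_aux S (A := Set.univ) isClosed_univ (Set.mem_univ _)
  simpa only [lpValue, Set.mem_univ, implies_true, and_true] using h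

end BMatchingGame

/-! Everything rests on $\frac23\nu^*(V)\le\gamma(V)$ (`two_thirds_mul_lpValue_le_worth`). Split
each vertex $v$ into $b_v$ copies and spread an optimal fractional $b$-matching evenly over pairs of
copies. The result is a symmetric matrix with row sums at most 1; padding its diagonal makes it
doubly stochastic. By Birkhoff's theorem some permutation of the copies has arcs of total weight at
least $2\nu^*(V)$, each edge having been counted in both directions. The cycles of a permutation are
3-colourable, and the arcs leaving one colour class form a $b$-matching, so $2\nu^*(V)\le
3\gamma(V)$.

For the allocation, take an optimal dual solution $y$ on $G$ and pay $\frac23 b_v y_v$ to $v$. The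
total is at most $\frac23\nu^*(V)\le\gamma(V)$. Restricted to any $S$, $y$ is dual feasible for
$G[S]$, so weak duality gives $S$ at least $\frac23\nu^*(S)$. The unit triangle, with $\gamma=1$ and
$\nu^*=\frac32$, shows that $\frac23$ is optimal. -/

/-! ### Permutations: 3-colouring and Birkhoff's theorem -/

theorem Equiv.Perm.exists_three_coloring {I : Type*} [Finite I] (σ : Equiv.Perm I) :
    ∃ c : I → Fin 3, ∀ i, σ i ≠ i → c (σ i) ≠ c i := by
  classical
  have := Fintype.ofFinite I
  suffices h : ∀ s : Finset I, ∃ c : I → Fin 3, ∀ i ∈ s, σ i ∈ s → σ i ≠ i → c (σ i) ≠ c i by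
    obtain ⟨c, hc⟩ := h Finset.univ
    exact ⟨c, fun i => hc i (Finset.mem_univ _) (Finset.mem_univ _)⟩
  intro s
  induction s using Finset.induction_on with
  | empty => exact ⟨fun _ => 0, by simp⟩
  | insert a s ha ih =>
    obtain ⟨c, hc⟩ := ih
    -- The new point `a` has only two neighbours, its image and its preimage, so a third colour is
    -- free.
    have key : ∀ p q : Fin 3, ∃ k, p ≠ k ∧ q ≠ k := by decide
    obtain ⟨k, hk₁, hk₂⟩ := key (c (σ a)) (c (σ.symm a))
    refine ⟨Function.update c a k, fun i hi hσ hne => ?_⟩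
    rcases eq_or_ne i a with rfl | hia
    · rw [Function.update_self, Function.update_of_ne hne]
      exact hk₁
    · rw [Function.update_of_ne hia]
      rcases eq_or_ne (σ i) a with h | h
      · rw [h, Function.update_self]
        rw [← h, Equiv.symm_apply_apply] at hk₂
        exact hk₂.symm
      · rw [Function.update_of_ne h]
        exact hc i (Finset.mem_of_mem_insert_of_ne hi hia) (Finset.mem_of_mem_insert_of_ne hσ h) hne

/-- A linear functional on a doubly stochastic matrix is dominated by its value at some
permutation matrix. -/
theorem exists_perm_sum_le_of_mem_doublyStochastic {I : Type*} [Fintype I] [DecidableEq I]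
    {M : Matrix I I ℝ} (hM : M ∈ doublyStochastic ℝ I) (W : I → I → ℝ) :
    ∃ σ : Equiv.Perm I, ∑ i, ∑ j, W i j * M i j ≤ ∑ i, W i (σ i) := by
  obtain ⟨p, hp0, hp1, rfl⟩ := exists_eq_sum_perm_of_mem_doublyStochastic hM
  have hval : ∑ i, ∑ j, W i j * (∑ σ, p σ • σ.permMatrix ℝ) i j =
      ∑ σ : Equiv.Perm I, p σ * ∑ i, W i (σ i) := by
    simp only [Matrix.sum_apply, Matrix.smul_apply, smul_eq_mul, Finset.mul_sum]
    rw [Finset.sum_congr rfl fun i _ => Finset.sum_comm, Finset.sum_comm]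
    refine Finset.sum_congr rfl fun σ _ => ?_
    refine Finset.sum_congr rfl fun i _ => ?_
    rw [Finset.sum_eq_single (σ i)]
    · simp [Equiv.Perm.permMatrix, PEquiv.toMatrix_apply, mul_comm]
    · intro j _ hj
      simp [Equiv.Perm.permMatrix, PEquiv.toMatrix_apply, hj.symm]
    · simp
  -- Otherwise the convex combination would exceed every value that it averages.
  by_contra! hlt
  rw [hval] at hlt
  have : ∑ σ : Equiv.Perm I, p σ * ∑ i, W i (σ i) ≤
      ∑ σ : Equiv.Perm I, p σ * ∑ τ : Equiv.Perm I, p τ * ∑ i, W i (τ i) :=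
    Finset.sum_le_sum fun σ _ => mul_le_mul_of_nonneg_left (hlt σ).le (hp0 σ)
  have hpos : ∃ σ, 0 < p σ := by
    by_contra! h
    have := Finset.sum_nonpos fun σ (_ : σ ∈ Finset.univ) => h σ
    rw [hp1] at this
    linarith
  obtain ⟨σ₀, hσ₀⟩ := hpos
  have hstrict : ∑ σ : Equiv.Perm I, p σ * ∑ i, W i (σ i) <
      ∑ σ : Equiv.Perm I, p σ * ∑ τ : Equiv.Perm I, p τ * ∑ i, W i (τ i) :=
    Finset.sum_lt_sum (fun σ _ => mul_le_mul_of_nonneg_left (hlt σ).le (hp0 σ))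
      ⟨σ₀, Finset.mem_univ _, mul_lt_mul_of_pos_left (hlt σ₀) hσ₀⟩
  rw [← Finset.sum_mul, hp1, one_mul] at hstrict
  exact lt_irrefl _ hstrict

/-! ### Linear programming duality by separation -/

theorem nonpos_of_forall_add_mul_le {a b r : ℝ} (h : ∀ k : ℝ, 0 ≤ k → a + k * b ≤ r) : b ≤ 0 := by
  by_contra! hb
  have := h ((|r - a| + 1) / b) (by positivity)
  rw [div_mul_cancel₀ _ hb.ne'] at this
  linarith [le_abs_self (r - a)]

theorem le_of_forall_add_mul_lt {a b r : ℝ} (h : ∀ ε : ℝ, 0 < ε → a + ε * b < r) : a ≤ r := by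
  by_contra! har
  have hb : 0 < |b| + 1 := by positivity
  have := h ((a - r) / (|b| + 1)) (div_pos (sub_pos.2 har) hb)
  have h2 : (a - r) / (|b| + 1) * (|b| + 1) = a - r := div_mul_cancel₀ _ hb.ne'
  nlinarith [neg_abs_le b, div_pos (sub_pos.2 har) hb]

/-- Strong duality for a linear program whose right-hand side is positive. -/
theorem exists_dual_of_forall_le {ι κ : Type*} [Fintype ι] [Fintype κ] (A : κ → ι → ℝ)
    (c : κ → ℝ) (w : ι → ℝ) (hc : ∀ v, 0 < c v) (M : ℝ)
    (h : ∀ x : ι → ℝ, (∀ i, 0 ≤ x i) → (∀ v, ∑ i, A v i * x i ≤ c v) → ∑ i, w i * x i ≤ M) :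
    ∃ y : κ → ℝ, (∀ v, 0 ≤ y v) ∧ (∀ i, w i ≤ ∑ v, y v * A v i) ∧ ∑ v, c v * y v ≤ M := by
  classical
  -- Pairs of a right-hand side and an objective value that some `x` beats strictly. Strictness
  -- makes `K` open, so that `(c, M)` can be separated from it; the normal `(g, l)` of the
  -- hyperplane yields the dual solution `-g / l`.
  set K : Set ((κ → ℝ) × ℝ) := {p | ∃ x : ι → ℝ, (∀ i, 0 ≤ x i) ∧
    (∀ v, ∑ i, A v i * x i < p.1 v) ∧ p.2 < ∑ i, w i * x i} with hK
  have hKo : IsOpen K := by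
    have : K = ⋃ x : ι → ℝ, ⋃ _ : ∀ i, 0 ≤ x i,
        (⋂ v, {p : (κ → ℝ) × ℝ | ∑ i, A v i * x i < p.1 v}) ∩ {p | p.2 < ∑ i, w i * x i} := by
      ext p
      simp only [hK, Set.mem_ofPred_eq, Set.mem_iUnion, Set.mem_inter_iff, Set.mem_iInter, exists_prop]
    rw [this]
    refine isOpen_iUnion fun x => isOpen_iUnion fun _ => (isOpen_iInter_of_finite fun v => ?_).inter ?_
    · exact isOpen_lt continuous_const (by fun_prop)
    · exact isOpen_lt continuous_snd continuous_const
  have hKc : Convex ℝ K := by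
    rintro p ⟨x, hx, hp1, hp2⟩ q ⟨z, hz, hq1, hq2⟩ a b ha hb hab
    have hlin : ∀ d : ι → ℝ, ∑ i, d i * (a * x i + b * z i) =
        a * ∑ i, d i * x i + b * ∑ i, d i * z i := by
      intro d
      rw [Finset.mul_sum, Finset.mul_sum, ← Finset.sum_add_distrib]
      exact Finset.sum_congr rfl fun i _ => by ring
    have hcomb : ∀ s t s' t' : ℝ, s < s' → t < t' → a * s + b * t < a * s' + b * t' := by
      intro s t s' t' h1 h2
      rcases ha.eq_or_lt with rfl | ha'
      · have : b = 1 := by linarith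
        subst this
        linarith
      · nlinarith [mul_lt_mul_of_pos_left h1 ha', mul_le_mul_of_nonneg_left h2.le hb]
    refine ⟨fun i => a * x i + b * z i, fun i => ?_, fun v => ?_, ?_⟩
    · have := hx i
      have := hz i
      positivity
    · rw [hlin]
      exact hcomb _ _ _ _ (hp1 v) (hq1 v)
    · rw [hlin]
      exact hcomb _ _ _ _ hp2 hq2
  have hnot : (c, M) ∉ K := by
    rintro ⟨x, hx, h1, h2⟩
    exact absurd (h x hx fun v => (h1 v).le) (not_le.2 h2)
  obtain ⟨f, hf⟩ := geometric_hahn_banach_open_point hKc hKo hnot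
  set g : κ → ℝ := fun v => f (Pi.single v 1, 0) with hg
  set l : ℝ := f (0, 1) with hl
  have hfe : ∀ s t, f (s, t) = ∑ v, s v * g v + t * l := by
    intro s t
    have hst : (s, t) = ∑ v, s v • ((Pi.single v 1, 0) : (κ → ℝ) × ℝ) + t • (0, 1) := by
      ext u
      · simp [Prod.fst_sum, Finset.sum_apply, Pi.single_apply]
      · simp [Prod.snd_sum]
    rw [hst, map_add, map_sum, map_smul]
    simp only [map_smul, smul_eq_mul, hg, hl]
  set R := ∑ v, c v * g v + M * l with hR
  -- Letting ε tend to 0 extends the separating inequality to weak constraints with slacks `s` and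
  -- `t`. Each sign condition below follows by going to infinity along one coordinate of `x`, `s` or
  -- `t`.
  have H : ∀ x : ι → ℝ, (∀ i, 0 ≤ x i) → ∀ (s : κ → ℝ) (t : ℝ), (∀ v, 0 ≤ s v) → 0 ≤ t →
      ∑ v, (∑ i, A v i * x i + s v) * g v + (∑ i, w i * x i - t) * l ≤ R := by
    intro x hx s t hs ht
    refine le_of_forall_add_mul_lt (b := ∑ v, g v - l) fun ε hε => ?_
    have := hf (fun v => ∑ i, A v i * x i + s v + ε, ∑ i, w i * x i - t - ε)
      ⟨x, hx, fun v => by dsimp only; linarith [hs v], by dsimp only; linarith⟩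
    rw [hfe, hfe] at this
    convert this using 1
    simp only [add_mul _ ε, Finset.sum_add_distrib, ← Finset.mul_sum]
    ring
  have hg0 : ∀ v, g v ≤ 0 := by
    intro v
    refine nonpos_of_forall_add_mul_le (a := 0) (r := R) fun k hk => ?_
    have := H 0 (by simp) (Pi.single v k) 0 (fun u => by
      rw [Pi.single_apply]; split_ifs <;> simp [hk]) le_rfl
    simpa [Pi.single_apply] using this
  have hl0 : 0 ≤ l := by
    have : -l ≤ 0 := by
      refine nonpos_of_forall_add_mul_le (a := 0) (r := R) fun k hk => ?_
      simpa using H 0 (by simp) 0 k (by simp) hk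
    linarith
  have hw : ∀ i, ∑ v, A v i * g v + w i * l ≤ 0 := by
    intro i
    refine nonpos_of_forall_add_mul_le (a := 0) (r := R) fun k hk => ?_
    have := H (Pi.single i k) (fun u => by
      rw [Pi.single_apply]; split_ifs <;> simp [hk]) 0 0 (by simp) le_rfl
    simp only [Pi.single_apply, mul_ite, mul_zero, Finset.sum_ite_eq',
      Finset.mem_univ, if_true, Pi.zero_apply, add_zero, sub_zero] at this
    convert this using 1
    rw [zero_add, mul_add, Finset.mul_sum]
    congr 1
    · exact Finset.sum_congr rfl fun v _ => by ring
    · ring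
  have hR0 : 0 ≤ R := by simpa using H 0 (by simp) 0 0 (by simp) le_rfl
  -- The hyperplane is not vertical: if `l = 0`, then `c > 0` forces `g = 0`, and the zero
  -- functional separates nothing strictly.
  have hlpos : 0 < l := by
    refine hl0.lt_of_ne fun hl' => ?_
    rw [hR, ← hl', mul_zero, add_zero] at hR0
    have hterm : ∀ v ∈ Finset.univ, c v * g v ≤ 0 := fun v _ =>
      mul_nonpos_of_nonneg_of_nonpos (hc v).le (hg0 v)
    have hz := (Finset.sum_eq_zero_iff_of_nonpos hterm).1
      (le_antisymm (Finset.sum_nonpos hterm) hR0)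
    have hgz : ∀ v, g v = 0 := fun v =>
      (mul_eq_zero.1 (hz v (Finset.mem_univ _))).resolve_left (hc v).ne'
    have := hf (fun _ => 1, -1) ⟨0, by simp, by simp, by simp⟩
    rw [hfe, hfe] at this
    simp [hgz, ← hl'] at this
  refine ⟨fun v => -g v / l, fun v => div_nonneg (neg_nonneg.2 (hg0 v)) hl0, fun i => ?_, ?_⟩
  · have : ∑ v, -g v / l * A v i = -(∑ v, A v i * g v) / l := by
      rw [← Finset.sum_neg_distrib, Finset.sum_div]
      exact Finset.sum_congr rfl fun v _ => by ring
    rw [this, le_div_iff₀ hlpos]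
    linarith [hw i]
  · have : ∑ v, c v * (-g v / l) = -(∑ v, c v * g v) / l := by
      rw [← Finset.sum_neg_distrib, Finset.sum_div]
      exact Finset.sum_congr rfl fun v _ => by ring
    rw [this, div_le_iff₀ hlpos]
    linarith

namespace BMatchingGame

/-! ### Sums over edges and over incidences -/

section Sums

variable {V : Type u} [Fintype V] (Γ : BMatchingGame V)

theorem mem_edgesIn_univ {e : Sym2 V} : e ∈ Γ.edgesIn Finset.univ ↔ e ∈ Γ.graph.edgeSet := by
  simp [edgesIn]

theorem mem_incidentIn_univ {e : Sym2 V} {v : V} :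
    e ∈ Γ.incidentIn Finset.univ v ↔ e ∈ Γ.graph.edgeSet ∧ v ∈ e := by
  simp [incidentIn, mem_edgesIn_univ]

open Classical in
theorem edgesIn_subset_univ (S : Finset V) : Γ.edgesIn S ⊆ Γ.edgesIn Finset.univ := by
  intro e he
  rw [mem_edgesIn_univ]
  exact (Finset.mem_filter.1 he).2.1

open Classical in
theorem le_cap_of_mem {S : Finset V} {x : Sym2 V → ℝ} (hx : Γ.IsFractionalBMatching S x)
    {e : Sym2 V} (he : e ∈ Γ.edgesIn S) {v : V} (hv : v ∈ e) : x e ≤ Γ.cap v := by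
  have hvS : v ∈ S := (Finset.mem_filter.1 he).2.2 v hv
  exact (Finset.single_le_sum (f := x) (fun e he => hx.2 e (Finset.mem_filter.1 he).1)
    (Finset.mem_filter.2 ⟨he, hv⟩)).trans (hx.1 v hvS)

open Classical in
theorem sum_incidentIn_univ (f : Sym2 V → ℝ) (u : V) :
    ∑ e ∈ Γ.incidentIn Finset.univ u, f e = ∑ v, if Γ.graph.Adj u v then f s(u, v) else 0 := by
  rw [← Finset.sum_filter]
  symm
  refine Finset.sum_bij (fun v _ => s(u, v)) (fun v hv => ?_) (fun v _ w _ h => ?_)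
    (fun e he => ?_) fun _ _ => rfl
  · simpa [mem_incidentIn_univ] using hv
  · exact Sym2.congr_right.1 h
  · obtain ⟨hadj, hu⟩ := Γ.mem_incidentIn_univ.1 he
    obtain ⟨v, rfl⟩ := Sym2.mem_iff_exists.1 hu
    exact ⟨v, by simpa using hadj, rfl⟩

open Classical in
theorem sum_sum_incidentIn (S : Finset V) (f : V → Sym2 V → ℝ) :
    ∑ v ∈ S, ∑ e ∈ Γ.incidentIn S v, f v e =
      ∑ e ∈ Γ.edgesIn S, ∑ v ∈ S with v ∈ e, f v e := by
  refine Finset.sum_comm' fun v e => ?_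
  simp only [incidentIn, Finset.mem_filter]
  tauto

open Classical in
theorem two_mul_sum_edgesIn_univ (f : Sym2 V → ℝ) :
    2 * ∑ e ∈ Γ.edgesIn Finset.univ, f e =
      ∑ u, ∑ v, if Γ.graph.Adj u v then f s(u, v) else 0 := by
  simp only [← sum_incidentIn_univ]
  rw [Γ.sum_sum_incidentIn Finset.univ fun _ e => f e, Finset.mul_sum]
  refine Finset.sum_congr rfl fun e he => ?_
  have hd : ¬ e.IsDiag := Γ.graph.not_isDiag_of_mem_edgeSet (Γ.mem_edgesIn_univ.1 he)
  have : (Finset.univ.filter fun v => v ∈ e) = e.toFinset := by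
    ext v
    simp
  rw [Finset.sum_const, this, Sym2.card_toFinset_of_not_isDiag e hd]
  simp

theorem worth_le_lpValue (S : Finset V) : Γ.worth S ≤ Γ.lpValue S := by
  obtain ⟨x, hx, hxe⟩ := (Γ.isGreatest_worth S).1
  exact hxe ▸ (Γ.isGreatest_lpValue S).2 ⟨x, hx.1, rfl⟩

end Sums

/-! ### Rounding a fractional b-matching -/

section Rounding

variable {V : Type u} [Fintype V] (Γ : BMatchingGame V)

open Classical in
/-- Splitting each vertex into as many copies as its capacity, a fractional `b`-matching yields
a permutation of the copies whose arcs have at least twice its weight. -/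
theorem exists_perm_two_mul_totalWeight_le {x : Sym2 V → ℝ}
    (hx : Γ.IsFractionalBMatching Finset.univ x) :
    ∃ σ : Equiv.Perm (Σ v, Fin (Γ.cap v)), 2 * Γ.totalWeight Finset.univ x ≤
      ∑ i, if Γ.graph.Adj i.1 (σ i).1 then Γ.weight s(i.1, (σ i).1) else 0 := by
  -- The value of an edge is shared equally among its pairs of copies, so the row of a copy of `u`
  -- sums to the load at `u` divided by its capacity. Vertices of capacity 0 have no copies, but `x`
  -- vanishes on their edges.
  set N : Matrix (Σ v, Fin (Γ.cap v)) (Σ v, Fin (Γ.cap v)) ℝ := fun i j =>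
    if Γ.graph.Adj i.1 j.1 then x s(i.1, j.1) / (Γ.cap i.1 * Γ.cap j.1) else 0 with hN
  have hx0 : ∀ u v, Γ.graph.Adj u v → 0 ≤ x s(u, v) := fun u v h =>
    hx.2 _ (Γ.mem_edgesIn_univ.2 h)
  have hxz : ∀ u v, Γ.graph.Adj u v → Γ.cap v = 0 → x s(u, v) = 0 := fun u v h h0 =>
    le_antisymm (by simpa [h0] using
      Γ.le_cap_of_mem hx (Γ.mem_edgesIn_univ.2 h) (Sym2.mem_mk_right u v)) (hx0 u v h)
  have hN0 : ∀ i j, 0 ≤ N i j := by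
    intro i j
    simp only [hN]
    split_ifs with h
    · have := hx0 _ _ h
      positivity
    · exact le_rfl
  have hsymm : ∀ i j, N i j = N j i := by
    intro i j
    simp only [hN, Γ.graph.adj_comm i.1 j.1, Sym2.eq_swap (a := i.1), mul_comm (Γ.cap i.1 : ℝ)]
  have hrow : ∀ i, ∑ j, N i j ≤ 1 := by
    rintro ⟨u, k⟩
    have hu : (0 : ℝ) < Γ.cap u := by exact_mod_cast k.pos
    have hdeg := hx.1 u (Finset.mem_univ u)
    rw [sum_incidentIn_univ] at hdeg
    calc ∑ j, N ⟨u, k⟩ j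
        ≤ ∑ v, (if Γ.graph.Adj u v then x s(u, v) else 0) / Γ.cap u := by
          rw [Fintype.sum_sigma]
          refine Finset.sum_le_sum fun v _ => ?_
          simp only [hN, Finset.sum_const, Finset.card_univ, Fintype.card_fin, nsmul_eq_mul]
          split_ifs with h
          · rcases Nat.eq_zero_or_pos (Γ.cap v) with h0 | h0
            · simp [h0, hxz u v h h0]
            · have : (0 : ℝ) < Γ.cap v := by exact_mod_cast h0
              apply le_of_eq
              field_simp
          · simp
      _ ≤ 1 := by
          rw [← Finset.sum_div, div_le_one hu]
          exact hdeg
  -- The diagonal padding carries no weight, since the graph has no loops.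
  set D : Matrix (Σ v, Fin (Γ.cap v)) (Σ v, Fin (Γ.cap v)) ℝ :=
    N + Matrix.diagonal fun i => 1 - ∑ j, N i j with hD
  have hDrow : ∀ i, ∑ j, D i j = 1 := by
    intro i
    simp [hD, Finset.sum_add_distrib, Matrix.diagonal_apply]
  have hDsymm : ∀ i j, D i j = D j i := by
    intro i j
    rcases eq_or_ne i j with rfl | hij
    · rfl
    · simp [hD, hij, hij.symm, hsymm i j]
  have hDS : D ∈ doublyStochastic ℝ _ := by
    rw [mem_doublyStochastic_iff_sum]
    refine ⟨fun i j => ?_, hDrow, fun j => ?_⟩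
    · refine add_nonneg (hN0 i j) ?_
      rw [Matrix.diagonal_apply]
      split_ifs
      · linarith [hrow i]
      · exact le_rfl
    · rw [← hDrow j]
      exact Finset.sum_congr rfl fun i _ => hDsymm i j
  obtain ⟨σ, hσ⟩ := exists_perm_sum_le_of_mem_doublyStochastic hDS
    fun i j => if Γ.graph.Adj i.1 j.1 then Γ.weight s(i.1, j.1) else 0
  refine ⟨σ, le_trans (le_of_eq ?_) hσ⟩
  rw [totalWeight, two_mul_sum_edgesIn_univ, Fintype.sum_sigma]
  refine Finset.sum_congr rfl fun u _ => ?_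
  have hinner : ∀ k : Fin (Γ.cap u), ∑ j : Σ v, Fin (Γ.cap v),
      (if Γ.graph.Adj u j.1 then Γ.weight s(u, j.1) else 0) * D ⟨u, k⟩ j =
      ∑ v, (if Γ.graph.Adj u v then Γ.weight s(u, v) * x s(u, v) else 0) / Γ.cap u := by
    intro k
    rw [Fintype.sum_sigma]
    refine Finset.sum_congr rfl fun v _ => ?_
    by_cases h : Γ.graph.Adj u v
    · have hDN : ∀ m : Fin (Γ.cap v), D ⟨u, k⟩ ⟨v, m⟩ = x s(u, v) / (Γ.cap u * Γ.cap v) := by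
        intro m
        have hne : (⟨u, k⟩ : Σ v, Fin (Γ.cap v)) ≠ ⟨v, m⟩ := fun he =>
          h.ne (congrArg Sigma.fst he)
        rw [hD, Matrix.add_apply, Matrix.diagonal_apply_ne _ hne, add_zero]
        exact if_pos h
      simp only [h, if_true, hDN, Finset.sum_const, Finset.card_univ, Fintype.card_fin,
        nsmul_eq_mul]
      rcases Nat.eq_zero_or_pos (Γ.cap v) with h0 | h0
      · simp [h0, hxz u v h h0]
      · have : (0 : ℝ) < Γ.cap v := by exact_mod_cast h0
        have hu : (0 : ℝ) < Γ.cap u := by exact_mod_cast k.pos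
        field_simp
    · simp [h]
  simp only [hinner, Finset.sum_const, Finset.card_univ, Fintype.card_fin, nsmul_eq_mul]
  rw [← Finset.sum_div]
  rcases Nat.eq_zero_or_pos (Γ.cap u) with h0 | h0
  · rw [h0]
    simp only [Nat.cast_zero, zero_mul]
    refine Finset.sum_eq_zero fun v _ => ?_
    split_ifs with h
    · rw [Sym2.eq_swap, hxz v u h.symm h0, mul_zero]
    · rfl
  · have hu : (0 : ℝ) < Γ.cap u := by exact_mod_cast h0
    field_simp

/-- Arcs whose sources and targets never coincide form a `b`-matching. -/
theorem exists_isBMatching_of_arcs (σ : Equiv.Perm (Σ v, Fin (Γ.cap v)))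
    (T : Finset (Σ v, Fin (Γ.cap v))) (hadj : ∀ i ∈ T, Γ.graph.Adj i.1 (σ i).1)
    (hT : ∀ i ∈ T, σ i ∉ T) :
    ∃ z, Γ.IsBMatching Finset.univ z ∧
      Γ.totalWeight Finset.univ z = ∑ i ∈ T, Γ.weight s(i.1, (σ i).1) := by
  classical
  set φ : (Σ v, Fin (Γ.cap v)) → Sym2 V := fun i => s(i.1, (σ i).1) with hφ
  have hφE : ∀ i ∈ T, φ i ∈ Γ.edgesIn Finset.univ := fun i hi =>
    Γ.mem_edgesIn_univ.2 (hadj i hi)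
  refine ⟨fun e => ((T.filter fun i => φ i = e).card : ℝ),
    ⟨⟨fun v _ => ?_, fun _ _ => Nat.cast_nonneg _⟩, fun e _ => ⟨_, (Int.cast_natCast _).symm⟩⟩, ?_⟩
  · rw [← Nat.cast_sum, Nat.cast_le]
    have h1 : ∑ e ∈ Γ.incidentIn Finset.univ v, (T.filter fun i => φ i = e).card =
        (T.filter fun i => v ∈ φ i).card := by
      rw [Finset.card_eq_sum_card_fiberwise (f := φ) (t := Γ.incidentIn Finset.univ v)]
      · refine Finset.sum_congr rfl fun e he => congrArg Finset.card ?_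
        ext i
        have := (Γ.mem_incidentIn_univ.1 he).2
        simp only [Finset.mem_filter]
        constructor
        · rintro ⟨h1, rfl⟩
          exact ⟨⟨h1, this⟩, rfl⟩
        · rintro ⟨⟨h1, -⟩, h2⟩
          exact ⟨h1, h2⟩
      · intro i hi
        obtain ⟨hi1, hi2⟩ := Finset.mem_filter.1 (Finset.mem_coe.1 hi)
        exact Finset.mem_coe.2 (Γ.mem_incidentIn_univ.2 ⟨hadj i hi1, hi2⟩)
    have h2 : (Finset.univ.filter fun j : Σ v, Fin (Γ.cap v) => j.1 = v).card = Γ.cap v := by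
      have : (Finset.univ.filter fun j : Σ v, Fin (Γ.cap v) => j.1 = v) =
          Finset.univ.map (Function.Embedding.sigmaMk v) := by
        ext ⟨u, k⟩
        simp only [Finset.mem_filter, Finset.mem_univ, true_and, Finset.mem_map,
          Function.Embedding.sigmaMk_apply]
        constructor
        · rintro rfl
          exact ⟨k, rfl⟩
        · rintro ⟨m, hm⟩
          exact (congrArg Sigma.fst hm).symm
      rw [this, Finset.card_map, Finset.card_univ, Fintype.card_fin]
    rw [h1]
    -- Each arc at `v` is charged to the copy of `v` that it uses. No copy is charged twice: `σ` is
    -- injective and no source is a target.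
    refine le_of_le_of_eq (Finset.card_le_card_of_injOn
      (fun i => if i.1 = v then i else σ i) (fun i hi => ?_) fun i hi j hj hij => ?_) h2
    · obtain ⟨-, hiv⟩ := Finset.mem_filter.1 (Finset.mem_coe.1 hi)
      simp only [Finset.coe_filter, Finset.mem_univ, true_and, Set.mem_ofPred_eq]
      split_ifs with h
      · exact h
      · exact ((Sym2.mem_iff.1 hiv).resolve_left (Ne.symm h)).symm
    · have hi' := (Finset.mem_filter.1 (Finset.mem_coe.1 hi)).1
      have hj' := (Finset.mem_filter.1 (Finset.mem_coe.1 hj)).1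
      dsimp only at hij
      split_ifs at hij
      · exact hij
      · exact absurd (hij ▸ hi') (hT j hj')
      · exact absurd (hij ▸ hj') (hT i hi')
      · exact σ.injective hij
  · rw [totalWeight, ← Finset.sum_fiberwise_of_maps_to hφE]
    refine Finset.sum_congr rfl fun e _ => ?_
    rw [Finset.sum_congr rfl fun i hi => congrArg Γ.weight (Finset.mem_filter.1 hi).2,
      Finset.sum_const, nsmul_eq_mul, mul_comm]

theorem two_thirds_mul_lpValue_le_worth :
    2 / 3 * Γ.lpValue Finset.univ ≤ Γ.worth Finset.univ := by
  classical
  obtain ⟨x, hx, hxe⟩ := (Γ.isGreatest_lpValue Finset.univ).1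
  obtain ⟨σ, hσ⟩ := Γ.exists_perm_two_mul_totalWeight_le hx
  obtain ⟨c, hc⟩ := σ.exists_three_coloring
  have hclass : ∀ k : Fin 3, ∑ i with c i = k,
      (if Γ.graph.Adj i.1 (σ i).1 then Γ.weight s(i.1, (σ i).1) else 0) ≤
        Γ.worth Finset.univ := by
    intro k
    obtain ⟨z, hz, hzw⟩ := Γ.exists_isBMatching_of_arcs σ
      (Finset.univ.filter fun i => c i = k ∧ Γ.graph.Adj i.1 (σ i).1)
      (fun i hi => (Finset.mem_filter.1 hi).2.2) fun i hi hσi => by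
        obtain ⟨-, hk, hadj⟩ := Finset.mem_filter.1 hi
        obtain ⟨-, hk', -⟩ := Finset.mem_filter.1 hσi
        -- Adjacency excludes fixed points of `σ`, the only places where the colouring says nothing.
        exact hc i (fun h => hadj.ne (congrArg Sigma.fst h.symm)) (hk'.trans hk.symm)
    rw [← Finset.sum_filter, Finset.filter_filter, ← hzw]
    exact (Γ.isGreatest_worth Finset.univ).2 ⟨z, hz, rfl⟩
  rw [← Finset.sum_fiberwise (g := c)] at hσ
  have hsum := hσ.trans (Finset.sum_le_sum fun k _ => hclass k)
  rw [Finset.sum_const, Finset.card_univ, Fintype.card_fin, hxe] at hsum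
  rw [nsmul_eq_mul] at hsum
  push_cast at hsum
  linarith

end Rounding

/-! ### Dual solutions as allocations -/

section Duality

variable {V : Type u} [Fintype V] (Γ : BMatchingGame V)

open Classical in
theorem exists_dual : ∃ y : V → ℝ, (∀ v, 0 ≤ y v) ∧
    (∀ e ∈ Γ.edgesIn Finset.univ, Γ.weight e ≤ ∑ v with v ∈ e, y v) ∧
    ∑ v, (Γ.cap v : ℝ) * y v ≤ Γ.lpValue Finset.univ := by
  -- The duality lemma needs positive right-hand sides. Edges with an end of capacity 0 are dropped;
  -- the constraints at such vertices then become vacuous, and their capacity may be raised to 1.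
  set E := (Γ.edgesIn Finset.univ).filter fun e => ∀ v ∈ e, 0 < Γ.cap v with hE
  obtain ⟨y, hy0, hyw, hyc⟩ := exists_dual_of_forall_le
    (fun (v : V) (e : Sym2 V) => if e ∈ E ∧ v ∈ e then (1 : ℝ) else 0)
    (fun v => max (Γ.cap v : ℝ) 1) (fun e => if e ∈ E then Γ.weight e else 0)
    (fun v => lt_max_of_lt_right one_pos) (Γ.lpValue Finset.univ) (by
      intro x hx0 hxc
      refine (Γ.isGreatest_lpValue Finset.univ).2
        ⟨fun e => if e ∈ E then x e else 0, ⟨fun v _ => ?_, fun e _ => ?_⟩, ?_⟩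
      · rcases Nat.eq_zero_or_pos (Γ.cap v) with h0 | h0
        · rw [h0, Nat.cast_zero]
          refine (Finset.sum_eq_zero fun e he => if_neg fun heE => ?_).le
          exact ((Finset.mem_filter.1 heE).2 v (Γ.mem_incidentIn_univ.1 he).2).ne' h0
        · have h1 : (1 : ℝ) ≤ Γ.cap v := by exact_mod_cast h0
          have := hxc v
          rw [max_eq_left h1] at this
          refine le_trans (le_of_eq ?_) this
          simp only [ite_mul, one_mul, zero_mul]
          rw [← Finset.sum_filter, ← Finset.sum_filter]
          refine Finset.sum_congr ?_ fun _ _ => rfl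
          ext e
          simp only [Finset.mem_filter, Finset.mem_univ, true_and, mem_incidentIn_univ, hE,
            mem_edgesIn_univ]
          tauto
      · dsimp only
        split_ifs
        · exact hx0 e
        · exact le_rfl
      · simp only [totalWeight, mul_ite, mul_zero, ite_mul, zero_mul]
        rw [← Finset.sum_filter, ← Finset.sum_filter]
        refine Finset.sum_congr ?_ fun _ _ => rfl
        ext e
        simp only [Finset.mem_filter, Finset.mem_univ, true_and, hE]
        tauto)
  -- A price large enough to cover any dropped edge; at a vertex of capacity 0 it costs nothing.
  set B := ∑ e, |Γ.weight e| with hB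
  have hB0 : 0 ≤ B := Finset.sum_nonneg fun _ _ => abs_nonneg _
  have hy'0 : ∀ v, 0 ≤ if Γ.cap v = 0 then B else y v := by
    intro v
    split_ifs
    · exact hB0
    · exact hy0 v
  refine ⟨fun v => if Γ.cap v = 0 then B else y v, hy'0, fun e he => ?_,
    le_trans (Finset.sum_le_sum fun v _ => ?_) hyc⟩
  · by_cases heE : e ∈ E
    · refine le_of_le_of_eq (le_of_eq_of_le (if_pos heE).symm (hyw e)) ?_
      simp only [heE, true_and, mul_ite, mul_one, mul_zero]
      rw [← Finset.sum_filter]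
      refine Finset.sum_congr rfl fun v hv => (if_neg ?_).symm
      exact ((Finset.mem_filter.1 heE).2 v (Finset.mem_filter.1 hv).2).ne'
    · have : ∃ v ∈ e, Γ.cap v = 0 := by
        by_contra! h
        exact heE (Finset.mem_filter.2 ⟨he, fun v hv => Nat.pos_of_ne_zero (h v hv)⟩)
      obtain ⟨v, hv, hv0⟩ := this
      calc Γ.weight e ≤ |Γ.weight e| := le_abs_self _
        _ ≤ B := Finset.single_le_sum (f := fun e => |Γ.weight e|)
            (fun _ _ => abs_nonneg _) (Finset.mem_univ e)
        _ = if Γ.cap v = 0 then B else y v := (if_pos hv0).symm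
        _ ≤ _ := Finset.single_le_sum (f := fun v => if Γ.cap v = 0 then B else y v)
            (fun u _ => hy'0 u) (Finset.mem_filter.2 ⟨Finset.mem_univ v, hv⟩)
  · dsimp only
    split_ifs with h
    · rw [h, Nat.cast_zero, zero_mul]
      exact mul_nonneg (le_max_of_le_right zero_le_one) (hy0 v)
    · exact mul_le_mul_of_nonneg_right (le_max_left _ _) (hy0 v)

open Classical in
-- Weak duality. One `y` serves all coalitions because an edge of `G[S]` has both ends in `S`, so
-- its dual constraint involves only prices in `S`.
theorem lpValue_le_of_dual {y : V → ℝ} (hy0 : ∀ v, 0 ≤ y v)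
    (hyw : ∀ e ∈ Γ.edgesIn Finset.univ, Γ.weight e ≤ ∑ v with v ∈ e, y v) (S : Finset V) :
    Γ.lpValue S ≤ ∑ v ∈ S, (Γ.cap v : ℝ) * y v := by
  obtain ⟨x, hx, hxe⟩ := (Γ.isGreatest_lpValue S).1
  rw [← hxe]
  calc ∑ e ∈ Γ.edgesIn S, Γ.weight e * x e
      ≤ ∑ e ∈ Γ.edgesIn S, ∑ v ∈ S with v ∈ e, y v * x e := by
        refine Finset.sum_le_sum fun e he => ?_
        rw [← Finset.sum_mul]
        refine mul_le_mul_of_nonneg_right ?_ (hx.2 e he)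
        refine le_of_le_of_eq (hyw e (Γ.edgesIn_subset_univ S he)) ?_
        refine Finset.sum_congr ?_ fun _ _ => rfl
        ext v
        have := (Finset.mem_filter.1 he).2.2 v
        simp only [Finset.mem_filter, Finset.mem_univ, true_and]
        tauto
    _ = ∑ v ∈ S, y v * ∑ e ∈ Γ.incidentIn S v, x e := by
        rw [← Γ.sum_sum_incidentIn S fun v e => y v * x e]
        simp only [Finset.mul_sum]
    _ ≤ ∑ v ∈ S, (Γ.cap v : ℝ) * y v := by
        refine Finset.sum_le_sum fun v hv => ?_
        rw [mul_comm]
        exact mul_le_mul_of_nonneg_right (hx.1 v hv) (hy0 v)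

theorem lpApproxCore_two_thirds_nonempty : (Γ.lpApproxCore (2 / 3)).Nonempty := by
  obtain ⟨y, hy0, hyw, hyc⟩ := Γ.exists_dual
  refine ⟨fun v => 2 / 3 * (Γ.cap v * y v), fun v => ?_, ?_, fun S => ?_⟩
  · have := hy0 v
    positivity
  · rw [← Finset.mul_sum]
    linarith [Γ.two_thirds_mul_lpValue_le_worth]
  · rw [← Finset.mul_sum]
    linarith [Γ.lpValue_le_of_dual hy0 hyw S]

theorem lpApproxCore_subset_approxCore {α : ℝ} (hα : 0 ≤ α) :
    Γ.lpApproxCore α ⊆ Γ.approxCore α := fun _ ⟨h0, h1, h2⟩ =>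
  ⟨h0, h1, fun S => (mul_le_mul_of_nonneg_left (Γ.worth_le_lpValue S) hα).trans (h2 S)⟩

end Duality

/-! ### Tightness: the unit triangle -/

section Triangle

/-- The triangle with unit capacities and unit weights. -/
def triangle : BMatchingGame (ULift.{u} (Fin 3)) where
  graph := ⊤
  cap := fun _ => 1
  weight := fun _ => 1

theorem three_halves_le_lpValue_triangle : 3 / 2 ≤ triangle.{u}.lpValue Finset.univ := by
  classical
  refine (triangle.isGreatest_lpValue Finset.univ).2
    ⟨fun _ => 1 / 2, ⟨fun v _ => ?_, fun _ _ => by norm_num⟩, ?_⟩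
  · rw [sum_incidentIn_univ, ← Finset.sum_filter, Finset.sum_const]
    have : (Finset.univ.filter fun w => triangle.graph.Adj v w).card = 2 := by
      have : (Finset.univ.filter fun w => triangle.graph.Adj v w) = Finset.univ.erase v := by
        ext w
        simp [triangle, eq_comm]
      rw [this, Finset.card_erase_of_mem (Finset.mem_univ v), Finset.card_univ]
      simp
    rw [this]
    simp [triangle]
  · have h := triangle.{u}.two_mul_sum_edgesIn_univ fun _ => 1 / 2
    have h6 : ∑ u : ULift.{u} (Fin 3), ∑ v : ULift.{u} (Fin 3),
        (if triangle.graph.Adj u v then (1 / 2 : ℝ) else 0) = 3 := by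
      rw [← Equiv.ulift.symm.sum_comp]
      simp_rw [← Equiv.ulift.{u}.symm.sum_comp]
      simp [triangle, Fin.sum_univ_three]
      norm_num
    rw [h6] at h
    simp only [totalWeight, triangle, one_mul] at h ⊢
    linarith

/-- Summing the three capacity constraints bounds twice the weight by 3, and the weight is an
integer. -/
theorem worth_triangle_le_one : triangle.{u}.worth Finset.univ ≤ 1 := by
  classical
  obtain ⟨x, hx, hxe⟩ := (triangle.{u}.isGreatest_worth Finset.univ).1
  have hint : ∃ k : ℤ, triangle.totalWeight Finset.univ x = k := by
    choose! k hk using hx.2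
    refine ⟨∑ e ∈ triangle.edgesIn Finset.univ, k e, ?_⟩
    rw [Int.cast_sum]
    exact Finset.sum_congr rfl fun e he => by rw [hk e he]; exact one_mul _
  have h3 : 2 * triangle.totalWeight Finset.univ x ≤ 3 := by
    have hs : triangle.totalWeight Finset.univ x = ∑ e ∈ triangle.edgesIn Finset.univ, x e :=
      Finset.sum_congr rfl fun e _ => one_mul _
    rw [hs, two_mul_sum_edgesIn_univ]
    simp only [← sum_incidentIn_univ]
    refine (Finset.sum_le_sum fun v hv => hx.1.1 v hv).trans ?_
    simp [triangle]
  obtain ⟨k, hk⟩ := hint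
  rw [← hxe, hk]
  rw [hk] at h3
  have : 2 * k ≤ 3 := by exact_mod_cast h3
  have : k ≤ 1 := by omega
  exact_mod_cast this

end Triangle

theorem isGreatest_lpFactors : IsGreatest lpFactors.{u} (2 / 3) := by
  refine ⟨fun V _ Γ => Γ.lpApproxCore_two_thirds_nonempty, fun α hα => ?_⟩
  obtain ⟨a, -, h1, h2⟩ := hα _ triangle
  by_contra! hlt
  nlinarith [h2 Finset.univ, three_halves_le_lpValue_triangle.{u}, worth_triangle_le_one.{u}]

theorem isLeast_integralityRatios : IsLeast integralityRatios.{u} (2 / 3) := by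
  have hlp := three_halves_le_lpValue_triangle.{u}
  have hpos : 0 < triangle.{u}.lpValue Finset.univ := by linarith
  refine ⟨⟨_, _, triangle, hpos, ?_⟩, ?_⟩
  -- For the triangle, `1 ≤ 2 / 3 * lpValue ≤ worth ≤ 1`, so equality holds throughout.
  · rw [eq_div_iff hpos.ne']
    linarith [triangle.{u}.two_thirds_mul_lpValue_le_worth, worth_triangle_le_one.{u}]
  · rintro _ ⟨V, _, Γ, h0, rfl⟩
    rw [le_div_iff₀ h0]
    exact Γ.two_thirds_mul_lpValue_le_worth

end BMatchingGame

theorem theorem3p4 :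
    (∀ (V : Type u) [Fintype V] (Γ : BMatchingGame V), (Γ.approxCore (2 / 3)).Nonempty) ∧
    IsGreatest BMatchingGame.lpFactors.{u} (2 / 3) ∧
    IsLeast BMatchingGame.integralityRatios.{u} BMatchingGame.integralityGap.{u} ∧
    BMatchingGame.integralityGap.{u} = 2 / 3 := by
  have hgap : BMatchingGame.integralityGap.{u} = 2 / 3 :=
    BMatchingGame.isLeast_integralityRatios.csInf_eq
  refine ⟨fun V _ Γ => ?_, BMatchingGame.isGreatest_lpFactors, ?_, hgap⟩
  · exact Γ.lpApproxCore_two_thirds_nonempty.mono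
      (Γ.lpApproxCore_subset_approxCore (by norm_num))
  · rw [hgap]
    exact BMatchingGame.isLeast_integralityRatios
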